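/- Let $X$ and $Y$ be Banach spaces, both real or both complex. A basis is an infinite sequence; it is unconditional if every vector has a unique expansion with respect to it and this expansion converges unconditionally. For $0<p<\infty$, an unconditional basis is said to have an upper $p$-estimate (respectively, a lower $p$-estimate) if there is a constant $0<C<\infty$ such that, for every finite sequence $x_1,\dots,x_n$ of vectors that are disjointly supported with respect to the basis, $$\Big\|\sum_{k=1}^n x_k\Big\|^p\le C^p\sum_{k=1}^n\|x_k\|^p\qquad\Big(\text{respectively, } \Big\|\sum_{k=1}^n x_k\Big\|^p\ge C^p\sum_{k=1}^n\|x_k\|^p\Big).$$ Suppose that $X$ has an unconditional basis with an upper $p$-estimate for some $0<p<\infty$, and that there is a bijection $U:X\to Y$ such that $U$ and $U^{-1}$ are both uniformly continuous. Then for every closed linear subspace $M$ of $Y$ and every $0<r<p$, the quotient space $Y/M$ has no unconditional basis with a lower $r$-estimate. -/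

import Mathlib

namespace UnconditionalSchauderBasis

variable {𝕜 X : Type*} [RCLike 𝕜] [NormedAddCommGroup X] [NormedSpace 𝕜 X]

/-- A finite sequence of vectors is disjointly supported with respect to the unconditional
basis `b`: no basis vector has a nonzero coefficient in two of its members. -/
def DisjointlySupported (b : UnconditionalSchauderBasis ℕ 𝕜 X) {n : ℕ} (x : Fin n → X) : Prop :=
  ∀ j k : Fin n, j ≠ k → Disjoint {i : ℕ | b.coord i (x j) ≠ 0} {i : ℕ | b.coord i (x k) ≠ 0}

/-- The unconditional basis `b` has an upper `p`-estimate. -/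
def HasUpperEstimate (b : UnconditionalSchauderBasis ℕ 𝕜 X) (p : ℝ) : Prop :=
  ∃ C : ℝ, 0 < C ∧ ∀ (n : ℕ) (x : Fin n → X), DisjointlySupported b x →
    ‖∑ k, x k‖ ^ p ≤ C ^ p * ∑ k, ‖x k‖ ^ p

/-- The unconditional basis `b` has a lower `p`-estimate. -/
def HasLowerEstimate (b : UnconditionalSchauderBasis ℕ 𝕜 X) (p : ℝ) : Prop :=
  ∃ C : ℝ, 0 < C ∧ ∀ (n : ℕ) (x : Fin n → X), DisjointlySupported b x →
    C ^ p * ∑ k, ‖x k‖ ^ p ≤ ‖∑ k, x k‖ ^ p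

end UnconditionalSchauderBasis

/-! Let `F` be `U` followed by the quotient map onto `Z = Y ⧸ M`. Measure a displacement in `X` by
the `ℓ^p`-sum of a disjoint decomposition, and a displacement in `Z` by `ℓ^r`-sums over disjoint
blocks. Since `F` is Lipschitz at large distances, the upper and lower estimates make it Lipschitz
in this sense at large scales (`exists_isBlockLipschitz`). Let `L₀` be the infimum of the constants;
it is positive because `F` is also co-Lipschitz at large distances.

Take a displacement of size `T` that nearly attains `L₀`, with midpoint `m`. Perturbing `m` by a
tail vector `v` of norm at most `σT/2` enlarges the `p`-th powers of the half-displacements only by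
a factor `1 + σ^p`. The blocks already in use exhaust almost all of the allowed `ℓ^r`-sum, so the
far coordinates of `F (m + v)` differ from those of one of two fixed points by at most order
`σ^(p/r) T` (`exists_approximate_midpoints`).

By the Gorelik principle (`exists_isCompact_gorelik`), a consequence of Brouwer's theorem, the
points `U (m + v)` cover, modulo a compact set, a ball of radius of order `σT`. Its image in `Z`
contains multiples of far basis vectors with norm of that order, while compact sets have small far
coordinates. Hence `σ ≤ const * σ^(p/r)`, which fails for small `σ` because `r < p`. -/

/-! ### Brouwer's theorem by volume computation, in the form of a zero theorem. -/

section Brouwer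

open MeasureTheory Metric Set Filter Topology Module

/-- A map that is Lipschitz on a closed ball and vanishes on its boundary sphere stays Lipschitz
when extended by zero. -/
theorem LipschitzOnWith.indicator_closedBall {E F : Type*} [NormedAddCommGroup E]
    [NormedSpace ℝ E] [NormedAddCommGroup F] {g : E → F} {ρ : ℝ} {L : NNReal}
    (hg : LipschitzOnWith L g (closedBall 0 ρ)) (h0 : ∀ x, ‖x‖ = ρ → g x = 0) :
    LipschitzWith L ((closedBall (0 : E) ρ).indicator g) := by
  have key : ∀ x ∈ closedBall (0 : E) ρ, ∀ y ∉ closedBall (0 : E) ρ,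
      dist (g x) 0 ≤ L * dist x y := by
    intro x hx y hy
    rw [mem_closedBall_zero_iff] at hx hy
    have hc : ContinuousOn (fun t : ℝ => ‖AffineMap.lineMap x y t‖) (Icc 0 1) := by
      apply Continuous.continuousOn
      exact continuous_norm.comp AffineMap.lineMap_continuous
    -- The segment from `x` to `y` meets the sphere, where `g` vanishes, at a point no farther from
    -- `x` than `y` is.
    obtain ⟨t, ht, hty⟩ := intermediate_value_Icc zero_le_one hc
      (show ρ ∈ Icc _ _ by simpa using ⟨hx, (not_le.1 hy).le⟩)
    simp only at hty
    set w := AffineMap.lineMap x y t with hw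
    have hxw : dist x w ≤ dist x y := by
      rw [hw, dist_left_lineMap, Real.norm_of_nonneg ht.1]
      exact mul_le_of_le_one_left dist_nonneg ht.2
    rw [← h0 w hty]
    refine (hg.dist_le_mul x (by simpa using hx) w (by simp [hty])).trans ?_
    gcongr
  refine LipschitzWith.of_dist_le_mul fun x y => ?_
  by_cases hx : x ∈ closedBall (0 : E) ρ <;> by_cases hy : y ∈ closedBall (0 : E) ρ
  · simpa [indicator_of_mem hx, indicator_of_mem hy] using hg.dist_le_mul x hx y hy
  · rw [indicator_of_mem hx, indicator_of_notMem hy]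
    exact key x hx y hy
  · rw [indicator_of_mem hy, indicator_of_notMem hx, dist_comm, dist_comm x y]
    exact key y hy x hx
  · rw [indicator_of_notMem hx, indicator_of_notMem hy, dist_self]
    positivity

/-- A contractive perturbation of the identity is bijective. -/
theorem LipschitzWith.bijective_id_add {E : Type*} [NormedAddCommGroup E] [NormedSpace ℝ E]
    [CompleteSpace E] {g : E → E} {c : NNReal} (hg : LipschitzWith c g) (hc : c < 1) :
    Function.Bijective fun x => x + g x := by
  have h : ApproximatesLinearOn (fun x => x + g x)
      ((ContinuousLinearEquiv.refl ℝ E : E ≃L[ℝ] E) : E →L[ℝ] E) univ c := by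
    rw [ApproximatesLinearOn.approximatesLinearOn_iff_lipschitzOnWith, lipschitzOnWith_univ]
    convert hg using 1
    ext x
    simp
  have h1 : Subsingleton E ∨
      c < ‖((ContinuousLinearEquiv.refl ℝ E).symm : E →L[ℝ] E)‖₊⁻¹ := by
    rcases subsingleton_or_nontrivial E with hE | hE
    · exact Or.inl hE
    · right
      simpa using hc
  exact ⟨injOn_univ.1 (h.injOn h1), h.surjective h1⟩

/-- The determinant of `1 + t • A` at `t = 1` is a fixed affine combination of its values at
points close to `0`. -/
theorem exists_interpolation_det_one_add_smul (E : Type*) [NormedAddCommGroup E]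
    [NormedSpace ℝ E] [FiniteDimensional ℝ E] {τ : ℝ} (hτ : 0 < τ) :
    ∃ (v w : ℕ → ℝ) (s : Finset ℕ), (∀ i ∈ s, 0 < v i ∧ v i < τ) ∧ ∑ i ∈ s, w i = 1 ∧
      ∀ A : E →L[ℝ] E, (1 + A).det = ∑ i ∈ s, w i * (1 + v i • A).det := by
  classical
  set n := finrank ℝ E
  -- The determinant has degree at most `n` in `t`, so `n + 1` distinct nodes suffice; the shift by
  -- 2 puts each of them strictly below `τ`.
  let v : ℕ → ℝ := fun i => τ / (i + 2)
  have hv : Set.InjOn v (Finset.range (n + 1) : Finset ℕ) := by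
    intro i _ j _ hij
    have h1 : (i : ℝ) + 2 ≠ 0 := by positivity
    have h2 : (j : ℝ) + 2 ≠ 0 := by positivity
    simp only [v] at hij
    rw [div_eq_div_iff h1 h2] at hij
    have := mul_left_cancel₀ hτ.ne' hij
    exact_mod_cast (add_right_cancel this).symm
  have hne : (Finset.range (n + 1)).Nonempty := by simp
  refine ⟨v, fun i => (Lagrange.basis (Finset.range (n + 1)) v i).eval 1, Finset.range (n + 1),
    fun i _ => ⟨by positivity, ?_⟩, ?_, fun A => ?_⟩
  · refine div_lt_self hτ ?_
    have : (0 : ℝ) ≤ i := by positivity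
    linarith
  · rw [← Polynomial.eval_finsetSum, Lagrange.sum_basis hv hne, Polynomial.eval_one]
  · let b := finBasis ℝ E
    let B := LinearMap.toMatrix b b (A : E →ₗ[ℝ] E)
    let P : Polynomial ℝ :=
      Matrix.det ((Polynomial.X : Polynomial ℝ) • B.map Polynomial.C +
        (1 : Matrix _ _ ℝ).map Polynomial.C)
    have hdeg : P.degree < (Finset.range (n + 1)).card := by
      refine (Polynomial.degree_le_natDegree).trans_lt ?_
      rw [Finset.card_range]
      have := Polynomial.natDegree_det_X_add_C_le B 1
      rw [Fintype.card_fin] at this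
      exact_mod_cast Nat.lt_succ_of_le this
    have heval : ∀ t : ℝ, P.eval t = (1 + t • A).det := by
      intro t
      have h1 : (1 + t • A).det = LinearMap.det ((1 : E →ₗ[ℝ] E) + t • (A : E →ₗ[ℝ] E)) := rfl
      rw [h1, ← LinearMap.det_toMatrix b, _root_.eval_det]
      congr 1
      ext i j
      by_cases hij : i = j <;>
      simp [B, hij, add_comm, mul_comm, LinearMap.toMatrix_one]
    have hP := Lagrange.eq_interpolate hv hdeg
    have h1 := heval 1
    rw [one_smul] at h1
    rw [← h1]
    conv_lhs => rw [hP]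
    rw [Lagrange.interpolate_apply, Polynomial.eval_finsetSum]
    refine Finset.sum_congr rfl fun i _ => ?_
    rw [Polynomial.eval_mul, Polynomial.eval_C, heval, mul_comm]

/-- There is no continuously differentiable map with values in a sphere which is the identity on
that sphere. -/
theorem not_exists_contDiff_retraction_sphere {E : Type*} [NormedAddCommGroup E]
    [InnerProductSpace ℝ E] [FiniteDimensional ℝ E] {ρ : ℝ} (hρ : 0 < ρ) {f : E → E}
    (hf : ContDiff ℝ 1 f) (hfρ : ∀ x, ‖f x‖ = ρ) (hid : ∀ x, ‖x‖ = ρ → f x = x) : False := by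
  borelize E
  let μ : Measure E := Measure.addHaar
  have hdiff : Differentiable ℝ f := hf.differentiable one_ne_zero
  have hcf : Continuous (fderiv ℝ f) := hf.continuous_fderiv one_ne_zero
  -- If the derivative were onto, some direction `w` would be sent to `f x`; differentiating the
  -- constant `‖f‖ ^ 2` along `w` would then give `ρ = 0`.
  have hdet0 : ∀ x, (fderiv ℝ f x).det = 0 := by
    intro x
    by_contra hne
    have hx : HasFDerivAt f (fderiv ℝ f x) x := (hdiff x).hasFDerivAt
    have h1 : HasFDerivAt (fun y => ‖f y‖ ^ 2) _ x := hx.norm_sq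
    have h2 : HasFDerivAt (fun y => ‖f y‖ ^ 2) (0 : E →L[ℝ] ℝ) x := by
      simp only [hfρ]
      exact hasFDerivAt_const _ _
    have h3 := h1.unique h2
    obtain ⟨w, hw⟩ := ((fderiv ℝ f x).toContinuousLinearEquivOfDetNeZero hne).surjective (f x)
    have h4 := congrArg (fun T : E →L[ℝ] ℝ => T w) h3
    rw [ContinuousLinearMap.toContinuousLinearEquivOfDetNeZero_apply] at hw
    simp [hw, hfρ] at h4
    exact hρ.ne' h4
  let G : E → E →L[ℝ] E := fun x => fderiv ℝ f x - 1
  have hG : Continuous G := by fun_prop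
  obtain ⟨L, hL0, hL⟩ : ∃ L : ℝ, 0 < L ∧ ∀ x ∈ closedBall (0 : E) ρ, ‖G x‖ ≤ L := by
    obtain ⟨C, hC⟩ := (isCompact_closedBall (0 : E) ρ).exists_bound_of_continuousOn hG.continuousOn
    exact ⟨max C 1, by positivity, fun x hx => (hC x hx).trans (le_max_left _ _)⟩
  have hGd : ∀ x, HasFDerivAt (fun y => f y - y) (G x) x := fun x =>
    (hdiff x).hasFDerivAt.sub (hasFDerivAt_id x)
  have hlip : LipschitzOnWith L.toNNReal (fun y => f y - y) (closedBall 0 ρ) := by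
    refine (convex_closedBall (0 : E) ρ).lipschitzOnWith_of_nnnorm_hasFDerivWithin_le
      (fun x _ => (hGd x).hasFDerivWithinAt) fun x hx => ?_
    rw [← NNReal.coe_le_coe, Real.coe_toNNReal _ hL0.le]
    exact hL x hx
  have hglob := hlip.indicator_closedBall (fun x hx => by simp [hid x hx])
  set g := (closedBall (0 : E) ρ).indicator (fun y => f y - y) with hgdef
  obtain ⟨δ, hδ, hδpos⟩ : ∃ δ > 0, ∀ B : E →L[ℝ] E, ‖B‖ < δ → 0 < (1 + B).det := by
    have hc : Continuous fun B : E →L[ℝ] E => (1 + B).det :=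
      ContinuousLinearMap.continuous_det.comp (continuous_const.add continuous_id)
    have h1 : ∀ᶠ B in 𝓝 (0 : E →L[ℝ] E), 0 < (1 + B).det := by
      refine hc.continuousAt.eventually (lt_mem_nhds ?_)
      have : (1 + 0 : E →L[ℝ] E).det = 1 := by
        rw [add_zero]; exact LinearMap.det_id
      exact one_pos.trans_eq this.symm
    obtain ⟨δ, hδ, h⟩ := Metric.eventually_nhds_iff.1 h1
    exact ⟨δ, hδ, fun B hB => h (by simpa using hB)⟩
  set τ := min (1 / L) (δ / L) with hτdef
  have hτ : 0 < τ := by positivity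
  have hball : MeasurableSet (ball (0 : E) ρ) := measurableSet_ball
  -- For small `t` the map `x + t • g x` is a bijection of the space that fixes the complement of
  -- the ball, hence maps the ball onto itself; its Jacobian is positive there, so it integrates to
  -- the volume.
  have hvol : ∀ t, 0 < t → t < τ → ∫ x in ball (0 : E) ρ, (1 + t • G x).det ∂μ =
      μ.real (ball (0 : E) ρ) := by
    intro t ht htτ
    have ht1 : t * L < 1 := by
      have := htτ.trans_le (min_le_left _ _)
      rwa [lt_div_iff₀ hL0] at this
    have ht2 : t * L < δ := by
      have := htτ.trans_le (min_le_right _ _)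
      rwa [lt_div_iff₀ hL0] at this
    have hlt : LipschitzWith (t * L).toNNReal (fun x => t • g x) := by
      refine LipschitzWith.of_dist_le_mul fun x y => ?_
      rw [dist_smul₀, Real.norm_of_nonneg ht.le, Real.coe_toNNReal _ (by positivity), mul_assoc]
      have := hglob.dist_le_mul x y
      rw [Real.coe_toNNReal _ hL0.le] at this
      gcongr
    have hbij := hlt.bijective_id_add (by
      rw [← NNReal.coe_lt_coe, Real.coe_toNNReal _ (by positivity)]; exact_mod_cast ht1)
    have hg0 : ∀ x, x ∉ ball (0 : E) ρ → g x = 0 := by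
      intro x hx
      rw [mem_ball_zero_iff, not_lt] at hx
      rcases hx.eq_or_lt with h | h
      · rw [hgdef, indicator_of_mem (by simp [h])]
        simp [hid x h.symm]
      · rw [hgdef, indicator_of_notMem (by simpa using h)]
    have himg : (fun x => x + t • g x) '' ball (0 : E) ρ = ball (0 : E) ρ := by
      have h1 : (fun x => x + t • g x) '' (ball (0 : E) ρ)ᶜ = (ball (0 : E) ρ)ᶜ := by
        conv_rhs => rw [← image_id (ball (0 : E) ρ)ᶜ]
        exact image_congr fun x hx => by simp [hg0 x hx]
      rw [image_compl_eq hbij] at h1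
      exact compl_injective h1
    have hder : ∀ x ∈ ball (0 : E) ρ,
        HasFDerivWithinAt (fun x => x + t • g x) (1 + t • G x) (ball (0 : E) ρ) x := by
      intro x hx
      have h1 : HasFDerivAt (fun y => y + t • (f y - y)) (1 + t • G x) x :=
        (hasFDerivAt_id x).add ((hGd x).const_smul t)
      refine h1.hasFDerivWithinAt.congr (fun y hy => ?_) ?_
      · rw [hgdef, indicator_of_mem (ball_subset_closedBall hy)]
      · rw [hgdef, indicator_of_mem (ball_subset_closedBall hx)]
    have h2 := integral_image_eq_integral_abs_det_fderiv_smul μ hball hder hbij.injective.injOn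
      (fun _ => (1 : ℝ))
    rw [himg] at h2
    simp only [smul_eq_mul, mul_one, integral_const, measureReal_restrict_apply_univ] at h2
    rw [h2]
    refine setIntegral_congr_fun hball fun x hx => ?_
    have : ‖t • G x‖ < δ := by
      rw [norm_smul, Real.norm_of_nonneg ht.le]
      exact (mul_le_mul_of_nonneg_left (hL x (ball_subset_closedBall hx)) ht.le).trans_lt ht2
    exact (abs_of_pos (hδpos _ this)).symm
  obtain ⟨v, w, s, hv, hw, hdet⟩ := exists_interpolation_det_one_add_smul E hτ
  have hint : ∀ i, IntegrableOn (fun x => w i * (1 + v i • G x).det) (ball (0 : E) ρ) μ := by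
    intro i
    have hc : Continuous fun x => w i * (1 + v i • G x).det := by
      refine continuous_const.mul (ContinuousLinearMap.continuous_det.comp ?_)
      fun_prop
    exact (hc.continuousOn.integrableOn_compact (isCompact_closedBall _ _)).mono_set
      ball_subset_closedBall
  -- Interpolation carries the volume identity to `t = 1`, where `1 + G x` is the singular
  -- derivative of `f`.
  have h0 : ∫ x in ball (0 : E) ρ, (1 + G x).det ∂μ = μ.real (ball (0 : E) ρ) := by
    rw [integral_congr_ae (ae_of_all _ fun x => hdet (G x)), integral_finsetSum _ fun i _ => hint i]
    simp only [integral_const_mul]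
    rw [Finset.sum_congr rfl fun i hi => by rw [hvol (v i) (hv i hi).1 (hv i hi).2],
      ← Finset.sum_mul, hw, one_mul]
  have h1 : ∀ x, (1 + G x).det = 0 := fun x => by simp [G, hdet0]
  simp only [h1, integral_zero] at h0
  have hpos : 0 < μ (ball (0 : E) ρ) := measure_ball_pos μ 0 hρ
  exact (ENNReal.toReal_pos hpos.ne' measure_ball_lt_top.ne).ne h0

/-- A continuous self-map of Euclidean space at bounded distance from the identity has a zero. -/
theorem exists_eq_zero_of_norm_sub_le_of_inner {E : Type*} [NormedAddCommGroup E]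
    [InnerProductSpace ℝ E] [FiniteDimensional ℝ E] {φ : E → E} (hφ : Continuous φ) {R : ℝ}
    (hR : ∀ x, ‖φ x - x‖ ≤ R) : ∃ x, φ x = 0 := by
  by_contra! hne
  have hR0 : 0 ≤ R := (norm_nonneg _).trans (hR 0)
  let χ : E → ℝ := fun x => max 0 (min 1 (R + 2 - ‖x‖))
  have hχ : Continuous χ := by fun_prop
  have hχ0 : ∀ x, 0 ≤ χ x := fun x => le_max_left _ _
  have hχ1 : ∀ x, χ x ≤ 1 := fun x => max_le zero_le_one (min_le_left _ _)
  -- The cutoff leaves `φ` unchanged for `‖x‖ ≤ R + 1`, and farther out a displacement of at most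
  -- `R` cannot reach zero.
  let Φ : E → E := fun x => x + χ x • (φ x - x)
  have hΦ : Continuous Φ := by fun_prop
  have hΦid : ∀ x, R + 2 ≤ ‖x‖ → Φ x = x := by
    intro x hx
    have : χ x = 0 := max_eq_left ((min_le_right _ _).trans (by linarith))
    simp [Φ, this]
  have hΦne : ∀ x, Φ x ≠ 0 := by
    intro x hx
    rcases le_or_gt ‖x‖ (R + 1) with h | h
    · have : χ x = 1 := by
        simp only [χ]
        rw [min_eq_left (by linarith), max_eq_right zero_le_one]
      exact hne x (by simpa [Φ, this] using hx)
    · have h1 : ‖χ x • (φ x - x)‖ ≤ R := by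
        rw [norm_smul, Real.norm_of_nonneg (hχ0 x)]
        exact (mul_le_of_le_one_left (norm_nonneg _) (hχ1 x)).trans (hR x)
      have h2 : x = -(χ x • (φ x - x)) := eq_neg_of_add_eq_zero_left hx
      have h3 : ‖x‖ ≤ R := by rw [h2, norm_neg]; exact h1
      linarith
  set S : Set E := (ball (0 : E) (R + 3))ᶜ
  set V : Set E := (closedBall (0 : E) (R + 2))ᶜ
  have hVo : IsOpen V := isClosed_closedBall.isOpen_compl
  have hVS : V ∈ 𝓝ˢ S := by
    rw [mem_nhdsSet_iff_exists]
    refine ⟨V, hVo, fun x hx => ?_, subset_rfl⟩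
    simp only [S, V, mem_compl_iff, mem_ball_zero_iff, mem_closedBall_zero_iff, not_lt, not_le]
      at hx ⊢
    linarith
  have hsm : ContDiffOn ℝ ((1 : ℕ∞) : WithTop ℕ∞) Φ V := by
    refine contDiffOn_id.congr fun x hx => hΦid x ?_
    simp only [V, mem_compl_iff, mem_closedBall_zero_iff, not_le] at hx
    exact hx.le
  -- An approximation error below `‖Φ x‖` keeps `Ψ` nonzero, so `Ψ` can be normalised to a
  -- retraction onto the sphere of radius `R + 3`.
  obtain ⟨Ψ, hΨ, hΨd, hΨS, -⟩ := hΦ.exists_contDiff_approx_and_eqOn 1 hΦ.norm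
    (fun x => norm_pos_iff.2 (hΦne x)) isOpen_ball.isClosed_compl hVS hsm
  have hΨne : ∀ x, Ψ x ≠ 0 := by
    intro x hx
    have := hΨd x
    rw [hx, dist_zero_left] at this
    exact lt_irrefl _ this
  have hρ : 0 < R + 3 := by linarith
  refine not_exists_contDiff_retraction_sphere hρ (f := fun x => ((R + 3) / ‖Ψ x‖) • Ψ x)
    ?_ ?_ ?_
  · have h1 : ContDiff ℝ 1 Ψ := by exact_mod_cast hΨ
    exact (contDiff_const.div (h1.norm ℝ hΨne) fun x => norm_ne_zero_iff.2 (hΨne x)).smul h1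
  · intro x
    have h1 := norm_pos_iff.2 (hΨne x)
    rw [norm_smul, Real.norm_of_nonneg (by positivity), div_mul_cancel₀ _ h1.ne']
  · intro x hx
    have h1 : Ψ x = x := by
      rw [hΨS (by simp [hx]), hΦid x (by linarith)]
    simp only [h1, hx, div_self hρ.ne', one_smul]

/-- A continuous self-map of a finite-dimensional space at bounded distance from the identity has
a zero. -/
theorem exists_eq_zero_of_norm_sub_le {V : Type*} [NormedAddCommGroup V] [NormedSpace ℝ V]
    [FiniteDimensional ℝ V] {φ : V → V} (hφ : Continuous φ) {R : ℝ}
    (hR : ∀ x, ‖φ x - x‖ ≤ R) : ∃ x, φ x = 0 := by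
  let e : V ≃L[ℝ] EuclideanSpace ℝ (Fin (finrank ℝ V)) := toEuclidean
  obtain ⟨x, hx⟩ := exists_eq_zero_of_norm_sub_le_of_inner (φ := fun x => e (φ (e.symm x)))
    (by fun_prop) (R := ‖(e : V →L[ℝ] EuclideanSpace ℝ (Fin (finrank ℝ V)))‖ * R) (fun x => by
      have h1 : e (φ (e.symm x)) - x = e (φ (e.symm x) - e.symm x) := by simp
      rw [h1]
      refine ((e : V →L[ℝ] EuclideanSpace ℝ (Fin (finrank ℝ V))).le_opNorm _).trans ?_
      gcongr
      exact hR _)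
  exact ⟨e.symm x, by simpa using hx⟩

end Brouwer
-- Uniformly continuous maps at large distances.
open Filter Topology Set Metric

/-- A uniformly continuous map on a normed space is Lipschitz for large distances. -/
theorem UniformContinuous.exists_norm_sub_le_mul {E F : Type*} [NormedAddCommGroup E]
    [NormedSpace ℝ E] [NormedAddCommGroup F] {f : E → F} (hf : UniformContinuous f) :
    ∃ Λ : ℝ, 0 < Λ ∧ ∀ (x y : E) (t : ℝ), 1 ≤ t → ‖x - y‖ ≤ t → ‖f x - f y‖ ≤ Λ * t := by
  obtain ⟨δ, hδ, h⟩ := Metric.uniformContinuous_iff.1 hf 1 one_pos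
  refine ⟨1 / δ + 1, by positivity, fun x y t ht hxy => ?_⟩
  -- Cut the segment into `n` pieces shorter than `δ`; since `1 ≤ t`, the rounding is absorbed into
  -- `Λ * t`.
  set n := ⌊t / δ⌋₊ + 1 with hn
  have hn0 : (0 : ℝ) < n := by positivity
  have htn : t / δ < n := by rw [hn]; push_cast; exact Nat.lt_floor_add_one _
  let w : ℕ → E := fun k => AffineMap.lineMap x y ((k : ℝ) / n)
  have hw : ∀ k, dist (f (w k)) (f (w (k + 1))) ≤ 1 := by
    intro k
    refine (h ?_).le
    simp only [w]
    rw [dist_lineMap_lineMap, dist_eq_norm x y, Real.dist_eq]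
    have : ((k : ℝ) / n - ((k + 1 : ℕ) : ℝ) / n) = -(1 / n) := by push_cast; ring
    rw [this, abs_neg, abs_of_pos (by positivity), one_div_mul_eq_div, div_lt_iff₀ hn0]
    rw [div_lt_iff₀ hδ] at htn
    linarith
  have h1 := dist_le_range_sum_dist (fun k => f (w k)) n
  have h2 : ∑ k ∈ Finset.range n, dist (f (w k)) (f (w (k + 1))) ≤ n := by
    refine (Finset.sum_le_sum fun k _ => hw k).trans ?_
    simp
  have hw0 : w 0 = x := by simp [w]
  have hwn : w n = y := by simp [w]
  simp only [hw0, hwn] at h1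
  rw [← dist_eq_norm]
  refine (h1.trans h2).trans ?_
  have h3 : (n : ℝ) ≤ t / δ + 1 := by
    rw [hn]; push_cast
    have := Nat.floor_le (show 0 ≤ t / δ by positivity)
    linarith
  have h4 : (1 / δ + 1) * t = t / δ + t := by ring
  linarith

/-! ### Basis projections, consequences of lower estimates, and the Gorelik principle. -/

namespace UnconditionalSchauderBasis

variable {𝕜 X : Type*} [RCLike 𝕜] [NormedAddCommGroup X] [NormedSpace 𝕜 X]

theorem coord_proj (b : UnconditionalSchauderBasis ℕ 𝕜 X) (A : Finset ℕ) (x : X) (i : ℕ) :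
    b.coord i (b.proj A x) = if i ∈ A then b.coord i x else 0 := by
  simp [b.ortho, Pi.single_apply]

theorem tendsto_proj_range (b : UnconditionalSchauderBasis ℕ 𝕜 X) (x : X) :
    Tendsto (fun N => b.proj (Finset.range N) x) atTop (𝓝 x) := by
  have h := b.tendsto_proj x
  rw [SummationFilter.unconditional_filter] at h
  exact h.comp tendsto_finset_range

theorem basis_ne_zero (b : UnconditionalSchauderBasis ℕ 𝕜 X) (j : ℕ) : b j ≠ 0 := by
  intro h
  have := b.ortho j j
  simp [h] at this

theorem proj_singleton_smul_basis (b : UnconditionalSchauderBasis ℕ 𝕜 X) (j : ℕ) (c : 𝕜) :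
    b.proj {j} (c • b j) = c • b j := by
  rw [map_smul, b.proj_apply_basis_mem, if_pos (Finset.mem_singleton_self j)]

theorem tendsto_proj_singleton (b : UnconditionalSchauderBasis ℕ 𝕜 X) (x : X) :
    Tendsto (fun j => b.proj {j} x) atTop (𝓝 0) := by
  have h1 := b.tendsto_proj_range x
  have h2 := ((tendsto_add_atTop_iff_nat 1).2 h1).sub h1
  rw [sub_self] at h2
  refine h2.congr fun j => ?_
  simp [Finset.sum_range_succ]

/-- The rank-one basis projections tend to zero uniformly on compact sets. -/
theorem exists_forall_norm_proj_singleton_le [CompleteSpace X]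
    (b : UnconditionalSchauderBasis ℕ 𝕜 X) {S : Set X} (hS : IsCompact S) {η : ℝ} (hη : 0 < η) :
    ∃ N, ∀ j ≥ N, ∀ x ∈ S, ‖b.proj {j} x‖ ≤ η := by
  obtain ⟨K, hK⟩ := b.exists_norm_proj_le
  have hK0 : 0 ≤ K := (norm_nonneg _).trans (hK ∅)
  -- Pointwise convergence on a finite net suffices, since the projections are bounded by `K`.
  obtain ⟨T, -, hT, hST⟩ := hS.finite_cover_balls (e := η / (2 * (K + 1))) (by positivity)
  have h1 : ∀ᶠ j in atTop, ∀ y ∈ T, ‖b.proj {j} y‖ < η / 2 := by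
    rw [eventually_all_finite hT]
    intro y _
    have := (b.tendsto_proj_singleton y).norm
    rw [norm_zero] at this
    exact this.eventually_lt_const (by positivity)
  obtain ⟨N, hN⟩ := eventually_atTop.1 h1
  refine ⟨N, fun j hj x hx => ?_⟩
  obtain ⟨y, hy, hxy⟩ := mem_iUnion₂.1 (hST hx)
  rw [mem_ball, dist_eq_norm, lt_div_iff₀ (by positivity)] at hxy
  have h2 : ‖b.proj {j} (x - y)‖ ≤ K * ‖x - y‖ :=
    ((b.proj {j}).le_opNorm _).trans (by gcongr; exact hK _)
  have h3 : b.proj {j} x = b.proj {j} (x - y) + b.proj {j} y := by rw [← map_add, sub_add_cancel]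
  rw [h3]
  refine (norm_add_le _ _).trans ?_
  have := hN j hj y hy
  have := norm_nonneg (x - y)
  linarith

theorem DisjointlySupported.smul {b : UnconditionalSchauderBasis ℕ 𝕜 X} {n : ℕ} {u : Fin n → X}
    (hu : DisjointlySupported b u) (c : 𝕜) : DisjointlySupported b fun k => c • u k := by
  refine fun j k hjk => (hu j k hjk).mono ?_ ?_ <;>
  · intro i hi h
    exact hi (by simp [h])

theorem DisjointlySupported.proj {b : UnconditionalSchauderBasis ℕ 𝕜 X} {n : ℕ} {u : Fin n → X}
    (hu : DisjointlySupported b u) (A : Finset ℕ) :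
    DisjointlySupported b fun k => b.proj A (u k) := by
  refine fun j k hjk => (hu j k hjk).mono ?_ ?_ <;>
  · intro i hi h
    refine hi ?_
    rw [coord_proj, h, ite_self]

/-- This lets a tail perturbation join a finitely supported displacement as one more disjoint piece,
so that its norm enters only through its `p`-th power. -/
theorem DisjointlySupported.cons {b : UnconditionalSchauderBasis ℕ 𝕜 X} {n N : ℕ} {u : Fin n → X}
    {v : X} (hu : DisjointlySupported b u) (huN : ∀ k, ∀ i ≥ N, b.coord i (u k) = 0)
    (hv : ∀ i < N, b.coord i v = 0) :
    DisjointlySupported b (Fin.cons v u : Fin (n + 1) → X) := by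
  have key : ∀ k, Disjoint {i : ℕ | b.coord i v ≠ 0} {i : ℕ | b.coord i (u k) ≠ 0} := by
    intro k
    rw [Set.disjoint_left]
    intro i hi hi'
    rcases lt_or_ge i N with h | h
    · exact hi (hv i h)
    · exact hi' (huN k i h)
  intro j k
  refine Fin.cases ?_ (fun j => ?_) j <;> refine Fin.cases ?_ (fun k => ?_) k
  · exact fun h => absurd rfl h
  · intro _
    simpa using key k
  · intro _
    simpa using (key j).symm
  · intro h
    simpa using hu j k fun h' => h (by rw [h'])

theorem disjointlySupported_proj (b : UnconditionalSchauderBasis ℕ 𝕜 X) {m : ℕ}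
    {A : Fin m → Finset ℕ} (hA : Pairwise (Function.onFun Disjoint A)) (x : X) :
    DisjointlySupported b fun k => b.proj (A k) x := by
  have key : ∀ k i, b.coord i (b.proj (A k) x) ≠ 0 → i ∈ A k := by
    intro k i h
    by_contra hi
    rw [coord_proj, if_neg hi] at h
    exact h rfl
  intro j k hjk
  rw [Set.disjoint_left]
  exact fun i hi hi' => Finset.disjoint_left.1 (hA hjk) (key j i hi) (key k i hi')

/-- A basis with a lower `r`-estimate controls the `ℓ^r`-sum of disjoint blocks of a vector. -/
theorem HasLowerEstimate.exists_sum_norm_proj_le [CompleteSpace X]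
    {b : UnconditionalSchauderBasis ℕ 𝕜 X} {r : ℝ} (hr : 0 < r) (h : HasLowerEstimate b r) :
    ∃ D : ℝ, 0 < D ∧ ∀ (m : ℕ) (A : Fin m → Finset ℕ), Pairwise (Function.onFun Disjoint A) →
      ∀ x : X, ∑ k, ‖b.proj (A k) x‖ ^ r ≤ (D * ‖x‖) ^ r := by
  obtain ⟨C, hC, h⟩ := h
  obtain ⟨K, hK⟩ := b.exists_norm_proj_le
  have hK0 : 0 ≤ K := (norm_nonneg _).trans (hK ∅)
  refine ⟨(K + 1) / C, by positivity, fun m A hA x => ?_⟩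
  have h1 := h m _ (b.disjointlySupported_proj hA x)
  have h2 : ∑ k, b.proj (A k) x = b.proj (Finset.univ.biUnion A) x := by
    simp only [GeneralSchauderBasis.proj_apply]
    rw [Finset.sum_biUnion fun i _ j _ hij => hA hij]
  have h3 : ‖∑ k, b.proj (A k) x‖ ≤ (K + 1) * ‖x‖ := by
    rw [h2]
    refine ((b.proj _).le_opNorm _).trans ?_
    gcongr
    exact (hK _).trans (by linarith)
  have h4 : (C ^ r) * ∑ k, ‖b.proj (A k) x‖ ^ r ≤ ((K + 1) * ‖x‖) ^ r :=
    h1.trans (Real.rpow_le_rpow (norm_nonneg _) h3 hr.le)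
  rw [div_mul_eq_mul_div, Real.div_rpow (by positivity) hC.le, le_div_iff₀ (by positivity),
    mul_comm]
  exact h4

/-- A basis cannot have a lower `r`-estimate with `r < 1`. -/
theorem not_hasLowerEstimate_of_lt_one (b : UnconditionalSchauderBasis ℕ 𝕜 X) {r : ℝ}
    (hr : 0 < r) (hr1 : r < 1) : ¬ HasLowerEstimate b r := by
  rintro ⟨C, hC, h⟩
  let e : ℕ → X := fun i => ((‖b i‖⁻¹ : ℝ) : 𝕜) • b i
  have he : ∀ i, ‖e i‖ = 1 := fun i => by
    have := norm_ne_zero_iff.2 (b.basis_ne_zero i)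
    simp [e, norm_smul, this]
  have key : ∀ n : ℕ, C ^ r * n ≤ (n : ℝ) ^ r := by
    intro n
    have hd : DisjointlySupported b fun k : Fin n => e k := by
      have h0 : ∀ k i : ℕ, b.coord i (e k) ≠ 0 → i = k := by
        intro k i hi
        by_contra hik
        exact hi (by simp [e, b.ortho, hik])
      intro j k hjk
      rw [Set.disjoint_left]
      intro i hi hi'
      exact hjk (Fin.ext ((h0 _ i hi).symm.trans (h0 _ i hi')))
    have h1 := h n _ hd
    simp only [he, Real.one_rpow, Finset.sum_const, Finset.card_univ, Fintype.card_fin,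
      nsmul_eq_mul, mul_one] at h1
    refine h1.trans (Real.rpow_le_rpow (norm_nonneg _) ?_ hr.le)
    refine (norm_sum_le _ _).trans ?_
    simp [he]
  have h1 : Tendsto (fun n : ℕ => (n : ℝ) ^ (1 - r)) atTop atTop :=
    (tendsto_rpow_atTop (by linarith)).comp tendsto_natCast_atTop_atTop
  obtain ⟨n, hn, hn0⟩ := ((h1.eventually_gt_atTop (1 / C ^ r)).and (eventually_gt_atTop 0)).exists
  have hn0' : (0 : ℝ) < n := by exact_mod_cast hn0
  have h2 : (n : ℝ) = (n : ℝ) ^ r * (n : ℝ) ^ (1 - r) := by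
    rw [← Real.rpow_add hn0', add_sub_cancel, Real.rpow_one]
  have h3 := key n
  have hCr : 0 < C ^ r := by positivity
  rw [div_lt_iff₀ hCr] at hn
  have h4 : (0 : ℝ) < (n : ℝ) ^ r := by positivity
  nlinarith

/-- **The Gorelik principle** along a basis: for a homeomorphism `U` whose inverse moves points at
distance at most `β` to points at distance at most `d`, every vector of norm at most `β` is, up to
a compact set, the image of a small perturbation of `m` by a vector in a tail of the basis. -/
theorem exists_isCompact_gorelik {Y : Type*} [NormedAddCommGroup Y]
    (b : UnconditionalSchauderBasis ℕ 𝕜 X) {K : ℝ}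
    (hK : ∀ A, ‖b.proj A‖ ≤ K) (U : X ≃ₜ Y) {β d : ℝ}
    (hU : ∀ y y', ‖y - y'‖ ≤ β → ‖U.symm y - U.symm y'‖ ≤ d) (N : ℕ) (m : X) :
    ∃ S : Set Y, IsCompact S ∧ ∀ y, ‖y‖ ≤ β → ∃ k ∈ S, ∃ v : X,
      (∀ i < N, b.coord i v = 0) ∧ ‖v‖ ≤ (K + 1) * d ∧ U (m + v) = k + y := by
  let ι : (Fin N → 𝕜) → X := fun a => ∑ i, a i • b i
  have hι : Continuous ι := by fun_prop
  let c : X →L[𝕜] (Fin N → 𝕜) := ContinuousLinearMap.pi fun i => b.coord i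
  have hcι : ∀ a, c (ι a) = a := by
    intro a
    ext i
    simp [c, ι, b.ortho, Pi.single_apply, Fin.val_inj]
  have hιc : ∀ x, ι (c x) = b.proj (Finset.range N) x := by
    intro x
    simp [c, ι, Finset.sum_range]
  refine ⟨(fun a => U (m + ι a)) '' closedBall 0 (‖c‖ * d),
    (isCompact_closedBall _ _).image (by fun_prop), fun y hy => ?_⟩
  have hd : ∀ a, ‖U.symm (U (m + ι a) + y) - (m + ι a)‖ ≤ d := by
    intro a
    have := hU (U (m + ι a) + y) (U (m + ι a)) (by simpa using hy)
    rwa [U.symm_apply_apply] at this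
  -- A zero of `φ` is a choice of `a` for which pulling `U (m + ι a) + y` back by `U` gives `m` plus
  -- a vector whose first `N` coordinates vanish.
  let φ : (Fin N → 𝕜) → (Fin N → 𝕜) := fun a => c (U.symm (U (m + ι a) + y) - m)
  have hφ : Continuous φ := by fun_prop
  have hφd : ∀ a, ‖φ a - a‖ ≤ ‖c‖ * d := by
    intro a
    have h1 : φ a - a = c (U.symm (U (m + ι a) + y) - (m + ι a)) := by
      simp only [φ]
      rw [← sub_sub, map_sub c _ (ι a), hcι]
    rw [h1]
    refine (c.le_opNorm _).trans ?_
    gcongr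
    exact hd a
  obtain ⟨a, ha⟩ := exists_eq_zero_of_norm_sub_le hφ hφd
  have han := hφd a
  rw [ha, zero_sub, norm_neg] at han
  refine ⟨_, ⟨a, by simpa using han, rfl⟩, U.symm (U (m + ι a) + y) - m, fun i hi => ?_, ?_, ?_⟩
  · exact congrFun ha ⟨i, hi⟩
  · set v := U.symm (U (m + ι a) + y) - m with hv
    have h1 : ‖v - ι a‖ ≤ d := by
      have := hd a
      rwa [← sub_sub] at this
    have h2 : b.proj (Finset.range N) (v - ι a) = -ι a := by
      rw [← hιc, map_sub, hcι]
      have : c v = 0 := ha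
      rw [this, zero_sub]
      simp [ι]
    have h3 : ‖ι a‖ ≤ K * d := by
      rw [← norm_neg, ← h2]
      refine ((b.proj _).le_opNorm _).trans ?_
      have := (norm_nonneg _).trans (hK ∅)
      gcongr
      exact hK _
    calc ‖v‖ = ‖(v - ι a) + ι a‖ := by rw [sub_add_cancel]
      _ ≤ d + K * d := (norm_add_le _ _).trans (add_le_add h1 h3)
      _ = (K + 1) * d := by ring
  · simp

end UnconditionalSchauderBasis

/-! ### Block Lipschitz constants and approximate midpoints. -/

namespace UnconditionalSchauderBasis

variable {𝕜 X Z : Type*} [RCLike 𝕜] [NormedAddCommGroup X] [NormedSpace 𝕜 X]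
  [NormedAddCommGroup Z] [NormedSpace 𝕜 Z]

/-- `F` is `L`-Lipschitz at scales above `s`, where displacements in the domain are measured by
`ℓ^p`-sums over disjoint decompositions, and displacements in the target by `ℓ^r`-sums over
disjoint blocks. -/
def IsBlockLipschitz (b : UnconditionalSchauderBasis ℕ 𝕜 X) (z : UnconditionalSchauderBasis ℕ 𝕜 Z)
    (p r : ℝ) (F : X → Z) (s L : ℝ) : Prop :=
  ∀ (x : X) (n : ℕ) (u : Fin n → X), DisjointlySupported b u →
    s ≤ (∑ k, ‖u k‖ ^ p) ^ (1 / p) → ∀ (m : ℕ) (A : Fin m → Finset ℕ),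
      Pairwise (Function.onFun Disjoint A) →
        ∑ k, ‖z.proj (A k) (F (x + ∑ k, u k) - F x)‖ ^ r ≤ (L * (∑ k, ‖u k‖ ^ p) ^ (1 / p)) ^ r

variable {b : UnconditionalSchauderBasis ℕ 𝕜 X} {z : UnconditionalSchauderBasis ℕ 𝕜 Z}
  {p r : ℝ} {F : X → Z}

theorem IsBlockLipschitz.mono {s s' L L' : ℝ} (h : IsBlockLipschitz b z p r F s L) (hr : 0 < r)
    (hs : s ≤ s') (hL0 : 0 ≤ L) (hL : L ≤ L') : IsBlockLipschitz b z p r F s' L' := by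
  intro x n u hu hsu m A hA
  refine (h x n u hu (hs.trans hsu) m A hA).trans ?_
  have : 0 ≤ (∑ k, ‖u k‖ ^ p) ^ (1 / p) := by positivity
  gcongr

/-- The upper estimate bounds the norm of the displacement by its `ℓ^p`-size, `F` carries this to
`Z`, and the lower estimate bounds the blocks there. Using `max C 1` keeps the distance bound at
least 1, as `hF` requires. -/
theorem exists_isBlockLipschitz [CompleteSpace Z] (hp : 0 < p) (hr : 0 < r)
    (hb : HasUpperEstimate b p) (hz : HasLowerEstimate z r) {Λ : ℝ} (hΛ : 0 < Λ)
    (hF : ∀ (x y : X) (t : ℝ), 1 ≤ t → ‖x - y‖ ≤ t → ‖F x - F y‖ ≤ Λ * t) :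
    ∃ L, 0 < L ∧ IsBlockLipschitz b z p r F 1 L := by
  obtain ⟨C, hC, hCb⟩ := hb
  obtain ⟨D, hD, hDz⟩ := hz.exists_sum_norm_proj_le hr
  refine ⟨D * (Λ * max C 1), by positivity, fun x n u hu hsu m A hA => ?_⟩
  set T := (∑ k, ‖u k‖ ^ p) ^ (1 / p) with hT
  have hS0 : 0 ≤ ∑ k, ‖u k‖ ^ p := by positivity
  have h1 : ‖∑ k, u k‖ ≤ max C 1 * T := by
    have h2 := Real.rpow_le_rpow (by positivity) (hCb n u hu) (show 0 ≤ 1 / p by positivity)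
    rw [Real.mul_rpow (by positivity) hS0, ← Real.rpow_mul (norm_nonneg _),
      ← Real.rpow_mul hC.le, mul_one_div_cancel hp.ne', Real.rpow_one, Real.rpow_one] at h2
    refine h2.trans ?_
    gcongr
    exact le_max_left _ _
  have h2 : 1 ≤ max C 1 * T := by
    have := le_max_right C 1
    nlinarith
  refine (hDz m A hA _).trans ?_
  have h3 := hF (x + ∑ k, u k) x _ h2 (by simpa using h1)
  refine Real.rpow_le_rpow (by positivity) ?_ hr.le
  calc D * ‖F (x + ∑ k, u k) - F x‖ ≤ D * (Λ * (max C 1 * T)) := by gcongr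
    _ = D * (Λ * max C 1) * T := by ring

/-- A map which is co-Lipschitz for large distances has block Lipschitz constants bounded below. -/
theorem IsBlockLipschitz.one_le_mul (hp : 0 < p) (hr : 0 < r) {Λ Λ' : ℝ}
    (hF : ∀ (x y : X) (t : ℝ), 1 ≤ t → ‖x - y‖ ≤ t → ‖F x - F y‖ ≤ Λ * t) {x₀ : X}
    (hco : ∀ (ζ : Z) (t : ℝ), 1 ≤ t → ‖ζ‖ ≤ t → ∃ x, F x - F x₀ = ζ ∧ ‖x - x₀‖ ≤ Λ' * t)
    {s L : ℝ} (hL : 0 < L) (h : IsBlockLipschitz b z p r F s L) : 1 ≤ L * Λ' := by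
  -- This exceeds `Λ * max s 1`, so a point whose image is displaced by `t` must itself have moved
  -- by at least `s`.
  set t := max 1 (Λ * max s 1 + 1) with ht
  have ht1 : 1 ≤ t := le_max_left _ _
  have ht0 : 0 < t := by linarith
  let ζ : Z := ((t * ‖z 0‖⁻¹ : ℝ) : 𝕜) • z 0
  have hζ : ‖ζ‖ = t := by
    have := norm_ne_zero_iff.2 (z.basis_ne_zero 0)
    simp only [ζ, norm_smul, RCLike.norm_ofReal, abs_mul, abs_inv, abs_norm, abs_of_pos ht0]
    field_simp
  obtain ⟨x, hx, hxt⟩ := hco ζ t ht1 hζ.le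
  have hs : s ≤ ‖x - x₀‖ := by
    by_contra! hlt
    have := hF x x₀ (max s 1) (le_max_right _ _) (hlt.le.trans (le_max_left _ _))
    rw [hx, hζ] at this
    have := le_max_right 1 (Λ * max s 1 + 1)
    linarith
  have hpow : (‖x - x₀‖ ^ p) ^ (1 / p) = ‖x - x₀‖ := by
    rw [← Real.rpow_mul (norm_nonneg _), mul_one_div_cancel hp.ne', Real.rpow_one]
  have h1 := h x₀ 1 (fun _ => x - x₀) (fun j k hjk => absurd (Subsingleton.elim j k) hjk)
    (by
      rw [Finset.univ_unique, Finset.sum_singleton, hpow]; exact hs) 1 (fun _ => {0})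
    (fun j k hjk => absurd (Subsingleton.elim j k) hjk)
  simp only [Finset.univ_unique, Finset.sum_const, Finset.card_singleton, one_smul,
    add_sub_cancel, hx, hpow] at h1
  rw [show z.proj {0} ζ = ζ from z.proj_singleton_smul_basis 0 _, hζ,
    Real.rpow_le_rpow_iff ht0.le (by positivity) hr] at h1
  have h2 : L * ‖x - x₀‖ ≤ L * (Λ' * t) := by gcongr
  have h3 : t ≤ L * Λ' * t := by linarith
  nlinarith

/-- The block Lipschitz estimate applied to half of a displacement, perturbed by a vector in a tail
of the basis. -/
theorem IsBlockLipschitz.half_add_le (hp : 0 < p) (hr : 0 < r) {s L σ : ℝ} (hL : 0 < L)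
    (h : IsBlockLipschitz b z p r F s L) {n N : ℕ} {u : Fin n → X} (hu : DisjointlySupported b u)
    (huN : ∀ k, ∀ i ≥ N, b.coord i (u k) = 0) {v : X} (hv : ∀ i < N, b.coord i v = 0)
    {T : ℝ} (hT : T = (∑ k, ‖u k‖ ^ p) ^ (1 / p)) (hsT : 2 * s ≤ T) (hσ : 0 ≤ σ)
    (hvT : ‖v‖ ≤ σ * (T / 2)) {m : ℕ} {A : Fin m → Finset ℕ}
    (hA : Pairwise (Function.onFun Disjoint A)) {B : Finset ℕ} (hB : ∀ k, Disjoint B (A k))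
    (x : X) :
    ‖z.proj B (F (x + (v + (2⁻¹ : 𝕜) • ∑ k, u k)) - F x)‖ ^ r +
      ∑ k, ‖z.proj (A k) (F (x + (v + (2⁻¹ : 𝕜) • ∑ k, u k)) - F x)‖ ^ r ≤
        (L * (T / 2)) ^ r * (1 + σ ^ p) ^ (r / p) := by
  have hS0 : 0 ≤ ∑ k, ‖u k‖ ^ p := by positivity
  have hT0 : 0 ≤ T := hT ▸ by positivity
  have hTp : T ^ p = ∑ k, ‖u k‖ ^ p := by
    rw [hT, ← Real.rpow_mul hS0, one_div_mul_cancel hp.ne', Real.rpow_one]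
  have hhalf : ∑ k, ‖(2⁻¹ : 𝕜) • u k‖ ^ p = (T / 2) ^ p := by
    rw [div_eq_inv_mul, Real.mul_rpow (by norm_num) hT0, hTp, Finset.mul_sum]
    refine Finset.sum_congr rfl fun k _ => ?_
    rw [norm_smul, Real.mul_rpow (norm_nonneg _) (norm_nonneg _)]
    simp
  have hsum : ∑ k, ‖(Fin.cons v (fun k => (2⁻¹ : 𝕜) • u k) : Fin (n + 1) → X) k‖ ^ p =
      ‖v‖ ^ p + (T / 2) ^ p := by
    rw [Fin.sum_univ_succ]
    simp only [Fin.cons_zero, Fin.cons_succ, hhalf]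
  have hsumv : ∑ k, (Fin.cons v (fun k => (2⁻¹ : 𝕜) • u k) : Fin (n + 1) → X) k =
      v + (2⁻¹ : 𝕜) • ∑ k, u k := by
    rw [Fin.sum_univ_succ]
    simp only [Fin.cons_zero, Fin.cons_succ, Finset.smul_sum]
  have hT2 : ((T / 2) ^ p) ^ (1 / p) = T / 2 := by
    rw [← Real.rpow_mul (by positivity), mul_one_div_cancel hp.ne', Real.rpow_one]
  have hAB : Pairwise (Function.onFun Disjoint (Fin.cons B A : Fin (m + 1) → Finset ℕ)) := by
    intro j k
    refine Fin.cases ?_ (fun j => ?_) j <;> refine Fin.cases ?_ (fun k => ?_) k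
    · exact fun h => absurd rfl h
    · intro _
      simpa [Function.onFun] using hB k
    · intro _
      simpa [Function.onFun] using (hB j).symm
    · intro h
      simpa [Function.onFun] using hA fun h' => h (by rw [h'])
  have h1 := h x (n + 1) (Fin.cons v fun k => (2⁻¹ : 𝕜) • u k)
    ((hu.smul _).cons (N := N) (fun k i hi => by simp [huN k i hi]) hv) (by
      rw [hsum]
      calc s ≤ T / 2 := by linarith
        _ = ((T / 2) ^ p) ^ (1 / p) := hT2.symm
        _ ≤ _ := by
          gcongr
          have : 0 ≤ ‖v‖ ^ p := by positivity
          linarith) (m + 1) _ hAB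
  rw [hsum, hsumv, Fin.sum_univ_succ] at h1
  simp only [Fin.cons_zero, Fin.cons_succ] at h1
  refine h1.trans ?_
  have h2 : ‖v‖ ^ p + (T / 2) ^ p ≤ (T / 2) ^ p * (1 + σ ^ p) := by
    have : ‖v‖ ^ p ≤ σ ^ p * (T / 2) ^ p := by
      rw [← Real.mul_rpow hσ (by positivity)]
      gcongr
    linarith
  have h3 : (‖v‖ ^ p + (T / 2) ^ p) ^ (1 / p) ≤ T / 2 * (1 + σ ^ p) ^ (1 / p) := by
    refine (Real.rpow_le_rpow (by positivity) h2 (by positivity)).trans_eq ?_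
    rw [Real.mul_rpow (by positivity) (by positivity), hT2]
  calc _ ≤ (L * (T / 2 * (1 + σ ^ p) ^ (1 / p))) ^ r := by gcongr
    _ = _ := by
      rw [← mul_assoc, Real.mul_rpow (by positivity) (by positivity), ← Real.rpow_mul (by positivity),
        one_div_mul_eq_div]

/-- Where the block Lipschitz estimate is almost attained, the images of approximate midpoints have
small blocks far out. -/
theorem exists_approximate_midpoints (hp : 0 < p) (hr : 1 ≤ r) (hF : Continuous F)
    {s L₁ L₂ σ : ℝ} (hs : 0 < s) (hL₁ : 0 < L₁) (hL₂ : 0 < L₂) (hσ : 0 ≤ σ)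
    (h₁ : IsBlockLipschitz b z p r F s L₁) (h₂ : ¬ IsBlockLipschitz b z p r F (3 * s) L₂) :
    ∃ (m : X) (N N' : ℕ) (T : ℝ) (y₁ y₂ : Z), 2 * s ≤ T ∧ ∀ v : X, (∀ i < N, b.coord i v = 0) →
      ‖v‖ ≤ σ * (T / 2) → ∃ y, (y = y₁ ∨ y = y₂) ∧ ∀ j ≥ N', ‖z.proj {j} (F (m + v) - y)‖ ^ r ≤
        (T / 2) ^ r * (L₁ ^ r * (1 + σ ^ p) ^ (r / p) - L₂ ^ r) := by
  have hr0 : 0 < r := by linarith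
  unfold IsBlockLipschitz at h₂
  push Not at h₂
  obtain ⟨x, n, u₀, hu₀, hsu₀, l, A, hA, hlt₀⟩ := h₂
  -- Truncating the pieces to finite support preserves the strict inequality; the slack between `3 *
  -- s` and `2 * s` absorbs the loss of size, and half-displacements still have size at least `s`.
  obtain ⟨N, u, T, hu, huN, hT, hsT, hlt⟩ : ∃ (N : ℕ) (u : Fin n → X) (T : ℝ),
      DisjointlySupported b u ∧ (∀ k, ∀ i ≥ N, b.coord i (u k) = 0) ∧
      T = (∑ k, ‖u k‖ ^ p) ^ (1 / p) ∧ 2 * s ≤ T ∧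
      (L₂ * T) ^ r < ∑ k, ‖z.proj (A k) (F (x + ∑ k, u k) - F x)‖ ^ r := by
    have ht : ∀ k, Tendsto (fun N => b.proj (Finset.range N) (u₀ k)) atTop (𝓝 (u₀ k)) :=
      fun k => b.tendsto_proj_range _
    have hT : Tendsto (fun N => (∑ k, ‖b.proj (Finset.range N) (u₀ k)‖ ^ p) ^ (1 / p)) atTop
        (𝓝 ((∑ k, ‖u₀ k‖ ^ p) ^ (1 / p))) := by
      refine (tendsto_finsetSum _ fun k _ => ?_).rpow_const (Or.inr (by positivity))
      exact (ht k).norm.rpow_const (Or.inr hp.le)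
    have hR : Tendsto (fun N => ∑ k,
        ‖z.proj (A k) (F (x + ∑ k, b.proj (Finset.range N) (u₀ k)) - F x)‖ ^ r) atTop
        (𝓝 (∑ k, ‖z.proj (A k) (F (x + ∑ k, u₀ k) - F x)‖ ^ r)) := by
      refine tendsto_finsetSum _ fun k _ => ?_
      refine Tendsto.rpow_const (Tendsto.norm ?_) (Or.inr hr0.le)
      have h1 : Continuous fun y => z.proj (A k) (F (x + y) - F x) := by fun_prop
      exact (h1.tendsto _).comp (tendsto_finsetSum _ fun k _ => ht k)
    have hL : Tendsto (fun N => (L₂ * (∑ k, ‖b.proj (Finset.range N) (u₀ k)‖ ^ p) ^ (1 / p)) ^ r)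
        atTop (𝓝 ((L₂ * (∑ k, ‖u₀ k‖ ^ p) ^ (1 / p)) ^ r)) :=
      (hT.const_mul L₂).rpow_const (Or.inr hr0.le)
    obtain ⟨N, h1, h2⟩ := ((hL.eventually_lt hR hlt₀).and
      (hT.eventually_const_lt (show 2 * s < _ by linarith))).exists
    refine ⟨N, _, _, hu₀.proj (Finset.range N), fun k i hi => ?_, rfl, h2.le, h1⟩
    rw [coord_proj, if_neg (by simpa using hi)]
  have hT0 : 0 < T := by linarith
  set x' := x + ∑ k, u k with hx'
  refine ⟨x + (2⁻¹ : 𝕜) • ∑ k, u k, N, (Finset.univ.biUnion A).sup id + 1, T, F x, F x', hsT,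
    fun v hv hvT => ?_⟩
  set w := x + (2⁻¹ : 𝕜) • ∑ k, u k + v with hw
  have hhalf : (2⁻¹ : 𝕜) • ∑ k, u k + (2⁻¹ : 𝕜) • ∑ k, u k = ∑ k, u k := by
    rw [← add_smul, show (2⁻¹ : 𝕜) + 2⁻¹ = 1 by norm_num, one_smul]
  have hwx : x + (v + (2⁻¹ : 𝕜) • ∑ k, u k) = w := by rw [hw]; abel
  have hwx' : w + (-v + (2⁻¹ : 𝕜) • ∑ k, u k) = x' := by
    rw [hw, hx']
    conv_rhs => rw [← hhalf]
    abel
  have hB : ∀ j ≥ (Finset.univ.biUnion A).sup id + 1, ∀ k, Disjoint {j} (A k) := by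
    intro j hj k
    rw [Finset.disjoint_singleton_left]
    intro hjk
    have : id j ≤ (Finset.univ.biUnion A).sup id :=
      Finset.le_sup (Finset.mem_biUnion.2 ⟨k, Finset.mem_univ k, hjk⟩)
    simp only [id] at this
    omega
  -- By Minkowski's inequality, which needs `1 ≤ r`, one of the two halves of the path through `w`
  -- carries at least `L₂ * T / 2` on the blocks `A k`; little is left for a further block `{j}`.
  have hmink : (∑ k, ‖z.proj (A k) (F x' - F x)‖ ^ r) ^ (1 / r) ≤
      (∑ k, ‖z.proj (A k) (F w - F x)‖ ^ r) ^ (1 / r) +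
        (∑ k, ‖z.proj (A k) (F x' - F w)‖ ^ r) ^ (1 / r) := by
    have h1 := Real.Lp_add_le Finset.univ (fun k => ‖z.proj (A k) (F w - F x)‖)
      (fun k => ‖z.proj (A k) (F x' - F w)‖) hr
    simp only [abs_norm] at h1
    refine le_trans ?_ h1
    gcongr with k
    rw [abs_of_nonneg (by positivity), ← sub_add_sub_cancel' (F w) (F x) (F x'), map_add]
    exact norm_add_le _ _
  have hlow : L₂ * T < (∑ k, ‖z.proj (A k) (F x' - F x)‖ ^ r) ^ (1 / r) := by
    have h1 := Real.rpow_lt_rpow (by positivity) hlt (show 0 < 1 / r by positivity)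
    rwa [← Real.rpow_mul (by positivity), mul_one_div_cancel hr0.ne', Real.rpow_one] at h1
  have hcase : ∀ ζ : Z, L₂ * T / 2 ≤ (∑ k, ‖z.proj (A k) ζ‖ ^ r) ^ (1 / r) →
      (T / 2) ^ r * L₂ ^ r ≤ ∑ k, ‖z.proj (A k) ζ‖ ^ r := by
    intro ζ hζ
    have h1 := Real.rpow_le_rpow (by positivity) hζ hr0.le
    rw [← Real.rpow_mul (by positivity), one_div_mul_cancel hr0.ne', Real.rpow_one] at h1
    rwa [← Real.mul_rpow (by positivity) hL₂.le, mul_comm, mul_div_assoc']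
  have hfin : ∀ P Q : ℝ, (T / 2) ^ r * L₂ ^ r ≤ Q →
      P + Q ≤ (L₁ * (T / 2)) ^ r * (1 + σ ^ p) ^ (r / p) →
      P ≤ (T / 2) ^ r * (L₁ ^ r * (1 + σ ^ p) ^ (r / p) - L₂ ^ r) := by
    intro P Q h1 h2
    rw [Real.mul_rpow hL₁.le (by positivity)] at h2
    linarith
  rcases le_or_gt (L₂ * T / 2) ((∑ k, ‖z.proj (A k) (F w - F x)‖ ^ r) ^ (1 / r)) with hc | hc
  · refine ⟨F x, Or.inl rfl, fun j hj => ?_⟩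
    have h1 := h₁.half_add_le hp hr0 hL₁ hu huN hv hT hsT hσ hvT hA (hB j hj) x
    rw [hwx] at h1
    exact hfin _ _ (hcase _ hc) h1
  · refine ⟨F x', Or.inr rfl, fun j hj => ?_⟩
    have h1 := h₁.half_add_le hp hr0 hL₁ hu huN (v := -v) (fun i hi => by simp [hv i hi]) hT hsT
      hσ (by simpa using hvT) hA (hB j hj) w
    rw [hwx'] at h1
    rw [← neg_sub, map_neg, norm_neg]
    exact hfin _ _ (hcase _ (by linarith)) h1

end UnconditionalSchauderBasis

/-! ### The contradiction at the optimal block Lipschitz constant. -/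

namespace UnconditionalSchauderBasis

/-- If `X` has a basis with an upper `p`-estimate and `Y` is uniformly homeomorphic to `X`, then no
basis of a linear quotient of `Y` has a lower `r`-estimate with `1 ≤ r < p`. -/
theorem HasUpperEstimate.not_hasLowerEstimate_of_surjective {𝕜 X Y Z : Type*} [RCLike 𝕜]
    [NormedAddCommGroup X] [NormedSpace 𝕜 X] [CompleteSpace X]
    [NormedAddCommGroup Y] [NormedSpace 𝕜 Y] [CompleteSpace Y]
    [NormedAddCommGroup Z] [NormedSpace 𝕜 Z] [CompleteSpace Z]
    {b : UnconditionalSchauderBasis ℕ 𝕜 X} {p : ℝ} (hb : HasUpperEstimate b p) (U : X ≃ᵤ Y)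
    (q : Y →L[𝕜] Z) (hq : Function.Surjective q) (z : UnconditionalSchauderBasis ℕ 𝕜 Z)
    {r : ℝ} (hr : 1 ≤ r) (hrp : r < p) : ¬ HasLowerEstimate z r := by
  intro hz
  have hr0 : 0 < r := by linarith
  have hp : 0 < p := by linarith
  let _ : NormedSpace ℝ X := NormedSpace.restrictScalars ℝ 𝕜 X
  let _ : NormedSpace ℝ Y := NormedSpace.restrictScalars ℝ 𝕜 Y
  obtain ⟨K, hK⟩ := b.exists_norm_proj_le
  have hK0 : 0 ≤ K := (norm_nonneg _).trans (hK ∅)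
  obtain ⟨Λ, hΛ, hUΛ⟩ := U.symm.uniformContinuous.exists_norm_sub_le_mul
  obtain ⟨c, hc, hqc⟩ := q.exists_preimage_norm_le hq
  let F : X → Z := fun x => q (U x)
  have hFu : UniformContinuous F := q.uniformContinuous.comp U.uniformContinuous
  obtain ⟨ΛF, hΛF, hF⟩ := hFu.exists_norm_sub_le_mul
  have hco : ∀ (ζ : Z) (t : ℝ), 1 ≤ t → ‖ζ‖ ≤ t →
      ∃ x, F x - F 0 = ζ ∧ ‖x - 0‖ ≤ Λ * max c 1 * t := by
    intro ζ t ht hζ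
    obtain ⟨y, hy, hyc⟩ := hqc ζ
    refine ⟨U.symm (U 0 + y), by simp [F, hy], ?_⟩
    have h1 := hUΛ (U 0 + y) (U 0) (max c 1 * t) (by nlinarith [le_max_right c 1])
      (by
        rw [add_sub_cancel_left]
        refine hyc.trans ?_
        gcongr
        exact le_max_left _ _)
    rw [U.symm_apply_apply] at h1
    linarith
  let 𝓛 : Set ℝ := {L | 0 < L ∧ ∃ s, IsBlockLipschitz b z p r F s L}
  obtain ⟨L', hL'0, hL'⟩ := exists_isBlockLipschitz hp hr0 hb hz hΛF hF
  have hne : 𝓛.Nonempty := ⟨L', hL'0, 1, hL'⟩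
  have hΛc : 0 < Λ * max c 1 := by positivity
  have hlow : ∀ L ∈ 𝓛, 1 / (Λ * max c 1) ≤ L := by
    rintro L ⟨hL0, s, hL⟩
    rw [div_le_iff₀ hΛc]
    exact hL.one_le_mul hp hr0 hF hco hL0
  have hbdd : BddBelow 𝓛 := ⟨_, hlow⟩
  set L₀ := sInf 𝓛
  have hL₀ : 0 < L₀ := (by positivity : 0 < 1 / (Λ * max c 1)).trans_le (le_csInf hne hlow)
  set κ := (K + 1) * Λ * c with hκ
  have hκ0 : 0 < κ := by positivity
  -- The only place where `r < p` must be strict: `σ ^ (p - r)` tends to zero.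
  obtain ⟨σ, hσ, hσκ⟩ : ∃ σ : ℝ, 0 < σ ∧ 2 * (3 * κ * L₀) ^ r * σ ^ p < σ ^ r := by
    have h1 : Tendsto (fun σ : ℝ => 2 * (3 * κ * L₀) ^ r * σ ^ (p - r)) (𝓝[>] 0) (𝓝 0) := by
      have h2 : ContinuousAt (fun σ : ℝ => 2 * (3 * κ * L₀) ^ r * σ ^ (p - r)) 0 :=
        continuousAt_const.mul (Real.continuousAt_rpow_const _ _ (Or.inr (by linarith)))
      have h3 := h2.tendsto
      rw [Real.zero_rpow (by linarith), mul_zero] at h3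
      exact h3.mono_left nhdsWithin_le_nhds
    obtain ⟨σ, h2, h3⟩ := ((h1.eventually_lt_const one_pos).and self_mem_nhdsWithin).exists
    have h3 : 0 < σ := h3
    refine ⟨σ, h3, ?_⟩
    have h4 : σ ^ p = σ ^ (p - r) * σ ^ r := by rw [← Real.rpow_add h3, sub_add_cancel]
    rw [h4, ← mul_assoc]
    exact mul_lt_of_lt_one_left (by positivity) h2
  have hσp : 0 < σ ^ p := by positivity
  have hL₀r : 0 < L₀ ^ r := by positivity
  have hcont : ContinuousAt (fun L : ℝ => L ^ r) L₀ :=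
    Real.continuousAt_rpow_const _ _ (Or.inl hL₀.ne')
  -- `L₁` and `L₂` are close enough to `L₀` that each costs at most `L₀ ^ r * σ ^ p / 2` in `hgap`.
  obtain ⟨L₁, hL₁r, hL₁⟩ : ∃ L₁, L₁ ^ r * (1 + σ ^ p) < L₀ ^ r * (1 + σ ^ p + σ ^ p / 2) ∧
      L₀ < L₁ := by
    have h1 : ∀ᶠ L in 𝓝[>] L₀, L ^ r * (1 + σ ^ p) < L₀ ^ r * (1 + σ ^ p + σ ^ p / 2) := by
      have h2 : ContinuousAt (fun L : ℝ => L ^ r * (1 + σ ^ p)) L₀ := hcont.mul continuousAt_const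
      refine (h2.tendsto.mono_left nhdsWithin_le_nhds).eventually_lt_const ?_
      exact mul_lt_mul_of_pos_left (by linarith) hL₀r
    exact (h1.and self_mem_nhdsWithin).exists
  obtain ⟨L₂, ⟨hL₂r, hL₂0⟩, hL₂⟩ : ∃ L₂, (L₀ ^ r * (1 - σ ^ p / 2) < L₂ ^ r ∧ 0 < L₂) ∧
      L₂ < L₀ := by
    have h1 : ∀ᶠ L in 𝓝[<] L₀, L₀ ^ r * (1 - σ ^ p / 2) < L ^ r :=
      (hcont.tendsto.mono_left nhdsWithin_le_nhds).eventually_const_lt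
        (mul_lt_of_lt_one_right hL₀r (by linarith))
    have h2 : ∀ᶠ L in 𝓝[<] L₀, 0 < L :=
      ((continuousAt_id (x := L₀)).tendsto.mono_left nhdsWithin_le_nhds).eventually_const_lt hL₀
    exact ((h1.and h2).and self_mem_nhdsWithin).exists
  have hL₁0 : 0 < L₁ := hL₀.trans hL₁
  have hgap : L₁ ^ r * (1 + σ ^ p) ^ (r / p) - L₂ ^ r ≤ 2 * L₀ ^ r * σ ^ p := by
    have h1 : (1 + σ ^ p) ^ (r / p) ≤ 1 + σ ^ p := by
      conv_rhs => rw [← Real.rpow_one (1 + σ ^ p)]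
      exact Real.rpow_le_rpow_of_exponent_le (by linarith) ((div_le_one hp).2 hrp.le)
    have h2 : L₁ ^ r * (1 + σ ^ p) ^ (r / p) ≤ L₁ ^ r * (1 + σ ^ p) := by gcongr
    linarith
  obtain ⟨L, ⟨hL0, s₀, hLs⟩, hLL₁⟩ := exists_lt_of_csInf_lt hne hL₁
  -- The last term forces `1 ≤ β` below, where the large-distance bound for `U.symm` is applied at
  -- distance `β`.
  set s := max (max s₀ 1) ((K + 1) * Λ / σ) with hs
  have hs0 : 0 < s := lt_of_lt_of_le one_pos ((le_max_right _ _).trans (le_max_left _ _))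
  have hbl₁ : IsBlockLipschitz b z p r F s L₁ :=
    hLs.mono hr0 ((le_max_left _ _).trans (le_max_left _ _)) hL0.le hLL₁.le
  have hbl₂ : ¬ IsBlockLipschitz b z p r F (3 * s) L₂ := fun h =>
    (csInf_le hbdd ⟨hL₂0, _, h⟩).not_gt hL₂
  obtain ⟨m, N, N', T, y₁, y₂, hT, hmid⟩ := exists_approximate_midpoints hp hr hFu.continuous hs0
    hL₁0 hL₂0 hσ.le hbl₁ hbl₂
  have hT0 : 0 < T := by linarith
  set β := σ * (T / 2) / ((K + 1) * Λ) with hβ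
  have hβ1 : 1 ≤ β := by
    rw [hβ, le_div_iff₀ (by positivity), one_mul]
    have h1 : (K + 1) * Λ / σ ≤ T / 2 := (le_max_right (max s₀ 1) _).trans (by linarith)
    rw [div_le_iff₀ hσ] at h1
    linarith
  have hβ0 : 0 < β := by linarith
  obtain ⟨S, hS, hSβ⟩ := b.exists_isCompact_gorelik hK U.toHomeomorph
    (fun y y' h => hUΛ y y' β hβ1 h) N m
  have hS' : IsCompact (q '' S ∪ {y₁, y₂}) :=
    (hS.image q.continuous).union (Set.toFinite _).isCompact
  set η := T / 2 * (2 * L₀ ^ r * σ ^ p) ^ (1 / r) with hη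
  have hη0 : 0 < η := by positivity
  have hηr : η ^ r = (T / 2) ^ r * (2 * L₀ ^ r * σ ^ p) := by
    rw [hη, Real.mul_rpow (by positivity) (by positivity), ← Real.rpow_mul (by positivity),
      one_div_mul_cancel hr0.ne', Real.rpow_one]
  obtain ⟨N₁, hN₁⟩ := z.exists_forall_norm_proj_singleton_le hS' hη0
  set j := max N' N₁
  -- The norm `β / c` is the largest for which the lift bound `c` guarantees a preimage in the ball
  -- of radius `β`.
  let ζ : Z := ((β / c * ‖z j‖⁻¹ : ℝ) : 𝕜) • z j
  have hζ : ‖ζ‖ = β / c := by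
    have := norm_ne_zero_iff.2 (z.basis_ne_zero j)
    simp only [ζ, norm_smul, RCLike.norm_ofReal, abs_mul, abs_inv, abs_norm,
      abs_of_pos (div_pos hβ0 hc)]
    field_simp
  obtain ⟨y, hy, hyc⟩ := hqc ζ
  rw [hζ, mul_div_cancel₀ _ hc.ne'] at hyc
  obtain ⟨k, hk, v, hv, hvn, hUv⟩ := hSβ y hyc
  have hdβ : (K + 1) * (Λ * β) = σ * (T / 2) := by rw [hβ]; field_simp
  rw [hdβ] at hvn
  obtain ⟨y', hy', hyj⟩ := hmid v hv hvn
  have h1 : ‖z.proj {j} (F (m + v) - y')‖ ≤ η := by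
    rw [← Real.rpow_le_rpow_iff (norm_nonneg _) hη0.le hr0, hηr]
    refine (hyj j (le_max_left _ _)).trans ?_
    gcongr
  have h2 : ‖z.proj {j} y'‖ ≤ η := hN₁ j (le_max_right _ _) y' (Or.inr hy')
  have h3 : ‖z.proj {j} (q k)‖ ≤ η := hN₁ j (le_max_right _ _) _ (Or.inl ⟨k, hk, rfl⟩)
  have h4 : ζ = z.proj {j} (F (m + v) - y') + z.proj {j} y' - z.proj {j} (q k) := by
    have h5 : F (m + v) = q k + ζ := by
      rw [← hy, ← map_add, ← hUv]
      rfl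
    rw [← map_add, ← map_sub, sub_add_cancel, h5, add_sub_cancel_left]
    exact (z.proj_singleton_smul_basis j _).symm
  have h5 : β / c ≤ 3 * η := by
    rw [← hζ, h4]
    refine (norm_sub_le _ _).trans ?_
    have := norm_add_le (z.proj {j} (F (m + v) - y')) (z.proj {j} y')
    linarith
  -- Here `T` cancels after taking `r`-th powers, leaving the reverse of the inequality that defined
  -- `σ`.
  have h6 : σ * (T / 2) ≤ 3 * κ * η := by
    have : β / c = σ * (T / 2) / κ := by rw [hβ, hκ, div_div]
    rw [this, div_le_iff₀ hκ0] at h5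
    linarith
  have h7 := Real.rpow_le_rpow (by positivity) h6 hr0.le
  rw [Real.mul_rpow hσ.le (by positivity), Real.mul_rpow (by positivity) hη0.le, hηr] at h7
  have h8 : (3 * κ * L₀) ^ r = (3 * κ) ^ r * L₀ ^ r :=
    Real.mul_rpow (by positivity) hL₀.le
  rw [h8] at hσκ
  have h9 : 0 < (T / 2) ^ r := by positivity
  have h10 := mul_lt_mul_of_pos_right hσκ h9
  linarith

end UnconditionalSchauderBasis

theorem theorem1p4 {𝕜 : Type*} [RCLike 𝕜]
    {X : Type*} [NormedAddCommGroup X] [NormedSpace 𝕜 X] [CompleteSpace X]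
    {Y : Type*} [NormedAddCommGroup Y] [NormedSpace 𝕜 Y] [CompleteSpace Y]
    (p : ℝ) (hp : 0 < p)
    (hX : ∃ b : UnconditionalSchauderBasis ℕ 𝕜 X,
      UnconditionalSchauderBasis.HasUpperEstimate b p)
    (hXY : Nonempty (X ≃ᵤ Y))
    (M : Submodule 𝕜 Y) [IsClosed (M : Set Y)]
    (r : ℝ) (hr : 0 < r) (hrp : r < p) :
    ¬ ∃ z : UnconditionalSchauderBasis ℕ 𝕜 (Y ⧸ M),
      UnconditionalSchauderBasis.HasLowerEstimate z r := by
  rintro ⟨z, hz⟩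
  obtain ⟨b, hb⟩ := hX
  obtain ⟨U⟩ := hXY
  -- For `r < 1` Minkowski's inequality is unavailable, but then the triangle inequality on
  -- normalised basis vectors already excludes a lower estimate.
  rcases lt_or_ge r 1 with hr1 | hr1
  · exact z.not_hasLowerEstimate_of_lt_one hr hr1 hz
  · exact hb.not_hasLowerEstimate_of_surjective U M.mkQL M.mkQ_surjective z hr1 hrp hz
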